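/- Conventions. A \emph{Riesz algebra} is a real associative algebra $A$ (not necessarily with an identity element) that is also a Riesz space (vector lattice) and in which products of positive elements are positive; $A^+$ is its positive cone. It is \emph{$\sigma$-Dedekind complete} if every non-empty at most countable subset that is bounded above has a supremum. Its multiplication is \emph{$\sigma$-monotone continuous} if $0\le a_n\uparrow a$ implies $ba_n\uparrow ba$ and $a_nb\uparrow ab$ for all $b\in A^+$. It is an \emph{$f$-algebra} if $x\wedge y=0$ implies $(zx)\wedge y=(xz)\wedge y=0$ for all $x,y,z\in A^+$; an $f$-algebra is \emph{semiprime} if $0$ is its only nilpotent element. A \emph{finite measure} on a measurable space $(X,\Omega)$ is a map $\mu:\Omega\to A^+$ such that $\mu(\emptyset)=0$ and $\mu\bigl(\bigcup_{n\ge1} A_n\bigr)=\bigvee_{N\ge1}\sum_{n=1}^N\mu(A_n)$ for all pairwise disjoint sequences $(A_n)$ in $\Omega$; it is \emph{spectral} if $\mu(A_1\cap A_2)=\mu(A_1)\mu(A_2)$ for all $A_1,A_2\in\Omega$. For a measurable function $\varphi:X\to[0,\infty)$ with finitely many values put $\int\varphi\,d\mu=\sum_{r}r\,\mu(\{\varphi=r\})\in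 A^+$; for a measurable $f:X\to[0,\infty)$ put $\int f\,d\mu=\bigvee_n\int\varphi_n\,d\mu\in A^+\cup\{\infty\}$, where $(\varphi_n)$ is any sequence of such functions with $\varphi_n\uparrow f$ pointwise. Let $\mathcal L^1(\mu)$ be the set of measurable $f:X\to\mathbb R$ with $\int|f|\,d\mu$ finite, let $I_\mu(f)=\int f^+\,d\mu-\int f^-\,d\mu$ for $f\in\mathcal L^1(\mu)$, and let $\mathcal B$ be the set of bounded measurable functions $f:X\to\mathbb R$. Operations and ordering on functions are pointwise. \textbf{Theorem.} Let $(X,\Omega)$ be a measurable space, let $A$ be a $\sigma$-Dedekind complete Riesz algebra with $\sigma$-monotone continuous multiplication, and let $\mu:\Omega\to A^+$ be a finite measure. The following are equivalent: (1) $\mathcal L^1(\mu)$ is a (commutative) algebra and $I_\mu:\mathcal L^1(\mu)\to A$ is an algebra homomorphism; (2) $I_\mu:\mathcal B\to A$ is an algebra homomorphism; (3) $\mu$ is a spectral measure; (4) $\mu(S)^2=\mu(S)$ for all $S\in\Omega$ and $\mu(S)\mu(T)=\mu(T)\mu(S)$ for all $S,T\in\Omega$. The following are also equivalent: (5) $I_\mu:\mathcal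 L^1(\mu)\to A$ is a vector lattice homomorphism; (6) $I_\mu:\mathcal B\to A$ is a vector lattice homomorphism; (7) $\mu(S\cap T)=\mu(S)\wedge\mu(T)$ for all $S,T\in\Omega$. Suppose that at least one of the following holds: (a) $A$ has a positive identity element $e$ and $\mu(X)\le e$; (b) $A$ is a semiprime $f$-algebra. Then each of the equivalent conditions (1)--(4) implies each of the equivalent conditions (5)--(7). -/

import Mathlib

open scoped NNReal

namespace OrderIntegration

/-- A Riesz algebra: a (not necessarily unital) associative real algebra that is also a
Riesz space (vector lattice), and in which products of positive elements are positive. -/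
class RieszAlgebra (A : Type*) [NonUnitalRing A] [Module ℝ A] [Lattice A] : Prop extends
    IsOrderedAddMonoid A, IsOrderedModule ℝ A, IsScalarTower ℝ A A, SMulCommClass ℝ A A where
  mul_nonneg : ∀ a b : A, 0 ≤ a → 0 ≤ b → 0 ≤ a * b

/-- Every non-empty at most countable subset that is bounded from above has a supremum. -/
def SigmaDedekindComplete (A : Type*) [Preorder A] : Prop :=
  ∀ s : Set A, s.Nonempty → s.Countable → BddAbove s → ∃ a, IsLUB s a

/-- If `0 ≤ aₙ ↑ a`, then `b aₙ ↑ b a` and `aₙ b ↑ a b` for all `b ≥ 0`. -/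
def SigmaMonotoneContinuousMul (A : Type*) [NonUnitalRing A] [Preorder A] : Prop :=
  ∀ (u : ℕ → A) (a : A), (∀ n, 0 ≤ u n) → Monotone u → IsLUB (Set.range u) a →
    ∀ b : A, 0 ≤ b →
      (Monotone (fun n => b * u n) ∧ IsLUB (Set.range fun n => b * u n) (b * a)) ∧
      (Monotone (fun n => u n * b) ∧ IsLUB (Set.range fun n => u n * b) (a * b))

/-- The defining property of `f`-algebras among the Riesz algebras. -/
def IsFAlgebra (A : Type*) [NonUnitalRing A] [Lattice A] : Prop :=
  ∀ x y z : A, 0 ≤ x → 0 ≤ y → 0 ≤ z → x ⊓ y = 0 → (z * x) ⊓ y = 0 ∧ (x * z) ⊓ y = 0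

/-- `0` is the only nilpotent element. The expression `(a * ·)^[n] a` is the power `a ^ (n + 1)`,
as `A` need not have an identity element. -/
def IsSemiprime (A : Type*) [NonUnitalRing A] : Prop :=
  ∀ a : A, (∃ n : ℕ, (fun b => a * b)^[n] a = 0) → a = 0

/-- A finite measure on the measurable space `X` with values in the positive cone of `A`, which is
countably additive with respect to the order of `A`. Only its values on measurable sets matter. -/
structure FiniteMeasure (X A : Type*) [MeasurableSpace X] [AddCommMonoid A] [Preorder A] where
  toFun : Set X → A
  nonneg : ∀ s, MeasurableSet s → 0 ≤ toFun s
  empty : toFun ∅ = 0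
  iUnion : ∀ s : ℕ → Set X, (∀ n, MeasurableSet (s n)) → Pairwise (fun i j => Disjoint (s i) (s j)) →
    IsLUB (Set.range fun N : ℕ => ∑ n ∈ Finset.range (N + 1), toFun (s n)) (toFun (⋃ n, s n))

instance (X A : Type*) [MeasurableSpace X] [AddCommMonoid A] [Preorder A] :
    CoeFun (FiniteMeasure X A) (fun _ => Set X → A) := ⟨FiniteMeasure.toFun⟩

section Integral

variable {X A : Type*} [MeasurableSpace X] [NonUnitalRing A] [Module ℝ A] [Lattice A]

/-- The order integral `∑ r μ(φ = r)` of an elementary function `φ : X → [0, ∞)`. -/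
noncomputable def elemIntegral (μ : FiniteMeasure X A) (φ : MeasureTheory.SimpleFunc X ℝ≥0) : A :=
  ∑ r ∈ φ.range, (r : ℝ) • μ (φ ⁻¹' {r})

/-- The order integral of `f : X → [0, ∞)` is finite and equal to `a`: there are elementary
functions `φₙ ↑ f` pointwise for which `a` is the supremum of the integrals of the `φₙ`.
(The supremum of these in `A ∪ {∞}` is finite precisely when they have a supremum in `A`.) -/
def HasOrderIntegral (μ : FiniteMeasure X A) (f : X → ℝ≥0) (a : A) : Prop :=
  ∃ φ : ℕ → MeasureTheory.SimpleFunc X ℝ≥0,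
    (∀ x, Monotone fun n => φ n x) ∧ (∀ x, IsLUB (Set.range fun n => φ n x) (f x)) ∧
    IsLUB (Set.range fun n => elemIntegral μ (φ n)) a

/-- The set `𝓛¹` of the measurable `f : X → ℝ` such that the order integral of `|f|` is finite. -/
def L1 (μ : FiniteMeasure X A) : Set (X → ℝ) :=
  {f | Measurable f ∧ ∃ a : A, HasOrderIntegral μ (fun x => Real.nnabs (f x)) a}

/-- The set of the bounded measurable functions. -/
def boundedMeasurable (X : Type*) [MeasurableSpace X] : Set (X → ℝ) :=
  {f | Measurable f ∧ ∃ C : ℝ, ∀ x, |f x| ≤ C}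

open Classical in
/-- The order integral of a function with values in `[0, ∞)` (and `0` if it is not finite). -/
noncomputable def posIntegral (μ : FiniteMeasure X A) (f : X → ℝ≥0) : A :=
  if h : ∃ a : A, HasOrderIntegral μ f a then h.choose else 0

/-- The integral operator `I_μ`, by splitting functions into positive and negative parts. -/
noncomputable def integral (μ : FiniteMeasure X A) (f : X → ℝ) : A :=
  posIntegral μ (fun x => (f x).toNNReal) - posIntegral μ (fun x => (-f x).toNNReal)

/-- `S` is an algebra (under the pointwise operations, hence commutative) of functions on `X`, and
the restriction of `T` to `S` is a homomorphism of real algebras. -/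
def IsAlgebraHomOn (T : (X → ℝ) → A) (S : Set (X → ℝ)) : Prop :=
  ∃ (R : NonUnitalSubalgebra ℝ (X → ℝ)) (Φ : R →ₙₐ[ℝ] A),
    (R : Set (X → ℝ)) = S ∧ ∀ f : R, Φ f = T f

/-- `S` is a vector lattice (under the pointwise operations and ordering) of functions on `X`, and
the restriction of `T` to `S` is a vector lattice homomorphism. -/
def IsVectorLatticeHomOn (T : (X → ℝ) → A) (S : Set (X → ℝ)) : Prop :=
  (∀ f ∈ S, ∀ g ∈ S, f ⊔ g ∈ S ∧ f ⊓ g ∈ S) ∧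
  (∃ (R : Submodule ℝ (X → ℝ)) (Φ : R →ₗ[ℝ] A), (R : Set (X → ℝ)) = S ∧ ∀ f : R, Φ f = T f) ∧
  ∀ f ∈ S, ∀ g ∈ S, T (f ⊔ g) = T f ⊔ T g ∧ T (f ⊓ g) = T f ⊓ T g

/-- A finite measure is spectral when `μ(s ∩ t) = μ(s) μ(t)` for all measurable `s`, `t`. -/
def IsSpectral (μ : FiniteMeasure X A) : Prop :=
  ∀ s t : Set X, MeasurableSet s → MeasurableSet t → μ (s ∩ t) = μ s * μ t

end Integral

end OrderIntegration

/-! Everything is decided on sets and then carried to functions by suprema. σ-Dedekind completeness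
makes `A` Archimedean, and countable additivity makes `μ` continuous from above at `∅`; an
Egorov-type argument (`elemIntegral_le_of_forall_le`) then shows that the integral does not depend
on the approximating sequence. Hence it is monotone, additive and positively homogeneous, and a
signed integral may be computed from any splitting into nonnegative integrable parts.

For spectral `μ` the elementary integral is multiplicative, and σ-monotone continuity of the
multiplication extends this to suprema, then to differences. Indicator functions give the converse.
For disjoint `s`, `t`, expanding the idempotent `μ (s ∪ t)` under commutativity yields `2 μ(s) μ(t)
= 0`, which gives spectrality.

If `μ` turns intersections into infima, functions with disjoint supports have disjoint integrals.
Thus the integrals of `f⁺` and `f⁻` are the positive and negative parts of the integral of `f`,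
which is all a lattice homomorphism needs.

The two halves are linked by disjoint sets: there `p = μ s` and `q = μ t` satisfy `p q = 0`, and
either extra assumption on `A` forces `p ⊓ q = 0`. -/

namespace OrderIntegration

open MeasureTheory Set

/-! ### Suprema and disjointness in the Riesz algebra -/

section Order

variable {A : Type*} [NonUnitalRing A] [Module ℝ A] [Lattice A] [RieszAlgebra A]

/-- The Archimedean property: if `s` is the supremum of the bounded multiples `n • w⁺`, then `s -
w⁺` is still an upper bound, so `w⁺ ≤ 0`. -/
theorem SigmaDedekindComplete.nonpos_of_le_smul (hA : SigmaDedekindComplete A) {w v : A}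
    (hv : 0 ≤ v) (h : ∀ ε : ℝ, 0 < ε → w ≤ ε • v) : w ≤ 0 := by
  have hbound : ∀ n : ℕ, (n : ℝ) • (w ⊔ 0) ≤ v := by
    intro n
    rcases Nat.eq_zero_or_pos n with rfl | hn
    · simpa using hv
    · have hn' : (0 : ℝ) < n := by exact_mod_cast hn
      have h1 : w ⊔ 0 ≤ (n : ℝ)⁻¹ • v :=
        sup_le (h _ (by positivity)) (smul_nonneg (by positivity) hv)
      have h2 := smul_le_smul_of_nonneg_left h1 hn'.le
      rwa [smul_smul, mul_inv_cancel₀ hn'.ne', one_smul] at h2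
  obtain ⟨s, hs⟩ := hA (range fun n : ℕ => (n : ℝ) • (w ⊔ 0)) (range_nonempty _)
    (countable_range _) ⟨v, by rintro _ ⟨n, rfl⟩; exact hbound n⟩
  have h1 : s ≤ s - (w ⊔ 0) := hs.2 (by
    rintro _ ⟨n, rfl⟩
    have h2 := hs.1 ⟨n + 1, rfl⟩
    simp only [Nat.cast_add, Nat.cast_one, add_smul, one_smul] at h2
    exact le_sub_iff_add_le.2 h2)
  have h2 : w ⊔ 0 ≤ 0 := by simpa using h1
  exact le_sup_left.trans h2

theorem isLUB_add_of_monotone {u v : ℕ → A} {a b : A} (hu : Monotone u) (hv : Monotone v)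
    (ha : IsLUB (range u) a) (hb : IsLUB (range v) b) :
    IsLUB (range fun n => u n + v n) (a + b) := by
  refine ⟨?_, fun c hc => ?_⟩
  · rintro _ ⟨n, rfl⟩
    exact add_le_add (ha.1 ⟨n, rfl⟩) (hb.1 ⟨n, rfl⟩)
  -- The term `u m + v n` lies below the diagonal term at `max m n`, so the two suprema can be taken
  -- one at a time.
  · have h1 : ∀ m, u m ≤ c - b := fun m => by
      rw [le_sub_comm]
      refine hb.2 ?_
      rintro _ ⟨n, rfl⟩
      rw [le_sub_iff_add_le']
      exact (add_le_add (hu (le_max_left m n)) (hv (le_max_right m n))).trans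
        (hc ⟨max m n, rfl⟩)
    rw [← le_sub_iff_add_le]
    exact ha.2 (by rintro _ ⟨n, rfl⟩; exact h1 n)

omit [Module ℝ A] [RieszAlgebra A] in
theorem isLUB_mul_of_monotone (hmul : SigmaMonotoneContinuousMul A) {u v : ℕ → A} {a b : A}
    (hu0 : ∀ n, 0 ≤ u n) (hv0 : ∀ n, 0 ≤ v n) (hu : Monotone u) (hv : Monotone v)
    (ha : IsLUB (range u) a) (hb : IsLUB (range v) b) :
    IsLUB (range fun n => u n * v n) (a * b) := by
  have hb0 : 0 ≤ b := (hv0 0).trans (hb.1 ⟨0, rfl⟩)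
  have hub := (hmul u a hu0 hu ha b hb0).2
  have hvm := fun m => (hmul v b hv0 hv hb (u m) (hu0 m)).1
  refine ⟨?_, fun c hc => hub.2.2 ?_⟩
  · rintro _ ⟨n, rfl⟩
    exact ((hvm n).2.1 ⟨n, rfl⟩).trans (hub.2.1 ⟨n, rfl⟩)
  · rintro _ ⟨m, rfl⟩
    refine (hvm m).2.2 ?_
    rintro _ ⟨n, rfl⟩
    exact ((hvm m).1 (le_max_right m n)).trans
      (((hmul u a hu0 hu ha _ (hv0 _)).2.1 (le_max_left m n)).trans (hc ⟨max m n, rfl⟩))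

theorem isLUB_smul {u : ℕ → A} {a : A} (ha : IsLUB (range u) a) {r : ℝ} (hr : 0 ≤ r) :
    IsLUB (range fun n => r • u n) (r • a) := by
  rcases hr.eq_or_lt with rfl | hr'
  · simp
  refine ⟨?_, fun c hc => ?_⟩
  · rintro _ ⟨n, rfl⟩
    exact smul_le_smul_of_nonneg_left (ha.1 ⟨n, rfl⟩) hr
  · have h1 : a ≤ r⁻¹ • c := ha.2 (by
      rintro _ ⟨n, rfl⟩
      have := smul_le_smul_of_nonneg_left (hc ⟨n, rfl⟩) (inv_nonneg.2 hr)
      simpa [smul_smul, inv_mul_cancel₀ hr'.ne'] using this)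
    have := smul_le_smul_of_nonneg_left h1 hr
    rwa [smul_smul, mul_inv_cancel₀ hr'.ne', one_smul] at this

theorem add_eq_sup_of_inf_eq_zero {x y : A} (h : x ⊓ y = 0) : x + y = x ⊔ y := by
  rw [← inf_add_sup x y, h, zero_add]

/-- Disjointness from a fixed element passes to suprema. -/
theorem inf_eq_zero_of_isLUB {u : ℕ → A} {a x : A} (hx : 0 ≤ x) (ha0 : 0 ≤ a)
    (ha : IsLUB (range u) a) (h : ∀ n, u n ⊓ x = 0) : a ⊓ x = 0 := by
  have hw : 0 ≤ a ⊓ x := le_inf ha0 hx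
  -- Each `u n` is disjoint from `a ⊓ x`, so their sum is their supremum, which is at most `a`.
  have h1 : a ≤ a - a ⊓ x := ha.2 (by
    rintro _ ⟨n, rfl⟩
    have hun : 0 ≤ u n := (h n).symm.le.trans inf_le_left
    have h2 : u n ⊓ (a ⊓ x) = 0 :=
      le_antisymm ((inf_le_inf_left _ inf_le_right).trans (h n).le) (le_inf hun hw)
    rw [le_sub_iff_add_le, add_eq_sup_of_inf_eq_zero h2]
    exact sup_le (ha.1 ⟨n, rfl⟩) inf_le_left)
  exact le_antisymm (by simpa using h1) hw

theorem smul_inf_smul_eq_zero {x y : A} (hx : 0 ≤ x) (hy : 0 ≤ y) (h : x ⊓ y = 0) {r : ℝ}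
    (hr : 0 ≤ r) : (r • x) ⊓ (r • y) = 0 := by
  rcases hr.eq_or_lt with rfl | hr'
  · simp
  refine le_antisymm ?_ (le_inf (smul_nonneg hr hx) (smul_nonneg hr hy))
  have h1 : r⁻¹ • ((r • x) ⊓ (r • y)) ≤ x ⊓ y := by
    refine le_inf ?_ ?_
    · have := smul_le_smul_of_nonneg_left (inf_le_left : (r • x) ⊓ (r • y) ≤ _)
        (inv_nonneg.2 hr)
      rwa [smul_smul r⁻¹ r, inv_mul_cancel₀ hr'.ne', one_smul] at this
    · have := smul_le_smul_of_nonneg_left (inf_le_right : (r • x) ⊓ (r • y) ≤ _)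
        (inv_nonneg.2 hr)
      rwa [smul_smul r⁻¹ r, inv_mul_cancel₀ hr'.ne', one_smul] at this
  have := smul_le_smul_of_nonneg_left (h1.trans h.le) hr
  rwa [smul_smul, mul_inv_cancel₀ hr'.ne', one_smul, smul_zero] at this

theorem mul_le_mul_of_nonneg' {a b c d : A} (hab : a ≤ b) (hcd : c ≤ d) (hb : 0 ≤ b)
    (hc : 0 ≤ c) : a * c ≤ b * d := by
  have h1 := RieszAlgebra.mul_nonneg (b - a) c (sub_nonneg.2 hab) hc
  have h2 := RieszAlgebra.mul_nonneg b (d - c) hb (sub_nonneg.2 hcd)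
  rw [sub_mul, sub_nonneg] at h1
  rw [mul_sub, sub_nonneg] at h2
  exact h1.trans h2

end Order

/-! ### Finite additivity and continuity of the measure -/

namespace FiniteMeasure

variable {X A : Type*} [MeasurableSpace X] [NonUnitalRing A] [Module ℝ A] [Lattice A]
  [RieszAlgebra A] (μ : FiniteMeasure X A)

theorem union {s t : Set X} (hs : MeasurableSet s) (ht : MeasurableSet t) (hst : Disjoint s t) :
    μ (s ∪ t) = μ s + μ t := by
  let S : ℕ → Set X := fun n => if n = 0 then s else if n = 1 then t else ∅
  have hS : ∀ n, MeasurableSet (S n) := fun n => by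
    simp only [S]; split_ifs <;> simp [hs, ht]
  have hd : Pairwise (fun i j => Disjoint (S i) (S j)) := fun i j hij => by
    simp only [S]
    split_ifs <;> first | (exfalso; omega) | simp [hst, hst.symm]
  have hU : ⋃ n, S n = s ∪ t := by
    ext x
    simp only [mem_iUnion, mem_union]
    constructor
    · rintro ⟨n, hn⟩
      simp only [S] at hn
      split_ifs at hn
      · exact Or.inl hn
      · exact Or.inr hn
      · exact hn.elim
    · rintro (h | h)
      · exact ⟨0, h⟩
      · exact ⟨1, h⟩
  have hlub := μ.iUnion S hS hd
  rw [hU] at hlub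
  -- The zeroth partial sum is `μ s` alone; from the next one on the sums are constant.
  have hsum : ∀ N, ∑ n ∈ Finset.range (N + 2), μ (S n) = μ s + μ t := fun N => by
    induction N with
    | zero => simp [Finset.sum_range_succ, S]
    | succ N ih => rw [Finset.sum_range_succ, ih]; simp [S, μ.empty]
  refine le_antisymm (hlub.2 ?_) ?_
  · rintro _ ⟨N, rfl⟩
    cases N with
    | zero => simpa [S] using μ.nonneg t ht
    | succ N => exact (hsum N).le
  · rw [← hsum 0]
    exact hlub.1 ⟨1, rfl⟩

theorem inter_add_diff {s t : Set X} (hs : MeasurableSet s) (ht : MeasurableSet t) :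
    μ (s ∩ t) + μ (s \ t) = μ s := by
  rw [← μ.union (hs.inter ht) (hs.diff ht) (disjoint_sdiff_inter).symm, inter_union_sdiff]

theorem mono {s t : Set X} (hs : MeasurableSet s) (ht : MeasurableSet t) (hst : s ⊆ t) :
    μ s ≤ μ t := by
  have h := μ.inter_add_diff ht hs
  rw [inter_eq_right.2 hst] at h
  rw [← h]
  exact le_add_of_nonneg_right (μ.nonneg _ (ht.diff hs))

theorem biUnion_finset {ι : Type*} (I : Finset ι) (S : ι → Set X)
    (hS : ∀ i ∈ I, MeasurableSet (S i)) (hd : (I : Set ι).PairwiseDisjoint S) :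
    μ (⋃ i ∈ I, S i) = ∑ i ∈ I, μ (S i) := by
  classical
  induction I using Finset.induction_on with
  | empty => simp [μ.empty]
  | insert i I hi ih =>
    rw [Finset.set_biUnion_insert, Finset.sum_insert hi, μ.union (hS i (by simp)) _ _, ih]
    · exact fun j hj => hS j (Finset.mem_insert_of_mem hj)
    · exact hd.subset (by simp)
    · exact Finset.measurableSet_biUnion _ fun j hj => hS j (Finset.mem_insert_of_mem hj)
    · rw [disjoint_iUnion₂_right]
      exact fun j hj => hd (by simp) (by simp [hj]) (fun h => hi (h ▸ hj))

/-- Continuity from above at the empty set. -/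
theorem nonpos_of_le_of_antitone {s : ℕ → Set X} (hs : ∀ n, MeasurableSet (s n))
    (hanti : Antitone s) (hempty : ⋂ n, s n = ∅) {w : A} (hw : ∀ n, w ≤ μ (s n)) : w ≤ 0 := by
  let t : ℕ → Set X := fun n => (s n)ᶜ
  have ht : ∀ n, MeasurableSet (t n) := fun n => (hs n).compl
  have hmono : Monotone t := fun i j hij => compl_subset_compl.2 (hanti hij)
  have hd : ∀ n, MeasurableSet (disjointed t n) := fun n => MeasurableSet.disjointed ht n
  -- Disjointing the increasing complements turns countable additivity into `μ (t N) ↑ μ univ`.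
  have hsum : ∀ N, ∑ n ∈ Finset.range (N + 1), μ (disjointed t n) = μ (t N) := fun N => by
    induction N with
    | zero => simp [disjointed_zero]
    | succ N ih =>
      rw [Finset.sum_range_succ, ih, hmono.disjointed_add_one, ← μ.union (ht N)
        ((ht _).diff (ht _)) disjoint_sdiff_right, union_sdiff_cancel (hmono (Nat.le_add_right N 1))]
  have hU : ⋃ n, disjointed t n = univ := by
    rw [iUnion_disjointed, ← compl_iInter, hempty, compl_empty]
  have hlub := μ.iUnion _ hd (disjoint_disjointed t)
  simp only [hsum, hU] at hlub
  -- As `w ≤ μ (s n)`, the complement has measure at most `μ univ - w`.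
  have : μ univ ≤ μ univ - w := hlub.2 (by
    rintro _ ⟨n, rfl⟩
    have h := μ.inter_add_diff MeasurableSet.univ (hs n)
    rw [univ_inter, ← compl_eq_univ_sdiff] at h
    rw [le_sub_iff_add_le, ← h, add_comm]
    exact add_le_add_left (hw n) _)
  simpa using this

end FiniteMeasure

/-! ### Integrals of elementary functions -/

section Elementary

variable {X A : Type*} [MeasurableSpace X] [NonUnitalRing A] [Module ℝ A] [Lattice A]
  [RieszAlgebra A] (μ : FiniteMeasure X A)

/-- This frees the integral from the level sets of the integrand. Applied to `φ.pair ψ`, it puts two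
elementary functions on a common partition. -/
theorem elemIntegral_map {β : Type*} (φ : SimpleFunc X β) (g : β → ℝ≥0) :
    elemIntegral μ (φ.map g) = ∑ b ∈ φ.range, (g b : ℝ) • μ (φ ⁻¹' {b}) := by
  classical
  rw [elemIntegral, SimpleFunc.range_map, ← Finset.sum_fiberwise_of_maps_to (g := g)
    (t := φ.range.image g) (fun b hb => Finset.mem_image_of_mem g hb)]
  refine Finset.sum_congr rfl fun r _ => ?_
  have h1 : φ.map g ⁻¹' {r} = ⋃ b ∈ φ.range.filter fun b => g b = r, φ ⁻¹' {b} := by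
    ext x; simp
  rw [h1, μ.biUnion_finset _ _ (fun b _ => φ.measurableSet_fiber b), Finset.smul_sum]
  · exact Finset.sum_congr rfl fun b hb => by rw [(Finset.mem_filter.1 hb).2]
  · exact (pairwise_disjoint_fiber _).set_pairwise _

theorem elemIntegral_nonneg (φ : SimpleFunc X ℝ≥0) : 0 ≤ elemIntegral μ φ :=
  Finset.sum_nonneg fun r _ => smul_nonneg r.2 (μ.nonneg _ (φ.measurableSet_fiber r))

theorem elemIntegral_add (φ ψ : SimpleFunc X ℝ≥0) :
    elemIntegral μ (φ + ψ) = elemIntegral μ φ + elemIntegral μ ψ := by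
  have h1 := elemIntegral_map μ (φ.pair ψ) (fun p => p.1 + p.2)
  have h2 := elemIntegral_map μ (φ.pair ψ) Prod.fst
  have h3 := elemIntegral_map μ (φ.pair ψ) Prod.snd
  rw [SimpleFunc.map_fst_pair] at h2
  rw [SimpleFunc.map_snd_pair] at h3
  rw [h2, h3, ← Finset.sum_add_distrib]
  exact h1.trans (Finset.sum_congr rfl fun p _ => by rw [NNReal.coe_add, add_smul])

theorem elemIntegral_mono {φ ψ : SimpleFunc X ℝ≥0} (h : ∀ x, φ x ≤ ψ x) :
    elemIntegral μ φ ≤ elemIntegral μ ψ := by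
  have h2 := elemIntegral_map μ (φ.pair ψ) Prod.fst
  have h3 := elemIntegral_map μ (φ.pair ψ) Prod.snd
  rw [SimpleFunc.map_fst_pair] at h2
  rw [SimpleFunc.map_snd_pair] at h3
  rw [h2, h3]
  refine Finset.sum_le_sum fun p hp => ?_
  obtain ⟨x, rfl⟩ := SimpleFunc.mem_range.1 hp
  exact smul_le_smul_of_nonneg_right (NNReal.coe_le_coe.2 (h x))
    (μ.nonneg _ (SimpleFunc.measurableSet_fiber _ _))

theorem elemIntegral_map_mul (r : ℝ≥0) (φ : SimpleFunc X ℝ≥0) :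
    elemIntegral μ (φ.map (r * ·)) = (r : ℝ) • elemIntegral μ φ := by
  rw [elemIntegral_map, elemIntegral, Finset.smul_sum]
  exact Finset.sum_congr rfl fun s _ => by rw [NNReal.coe_mul, mul_smul]

omit [RieszAlgebra A] in
theorem elemIntegral_restrict_const (c : ℝ≥0) {s : Set X} (hs : MeasurableSet s) :
    elemIntegral μ ((SimpleFunc.const X c).restrict s) = (c : ℝ) • μ s := by
  classical
  rcases eq_or_ne c 0 with rfl | hc
  · simp only [NNReal.coe_zero, zero_smul]
    refine Finset.sum_eq_zero fun r hr => ?_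
    obtain ⟨x, rfl⟩ := SimpleFunc.mem_range.1 hr
    simp [SimpleFunc.restrict_apply _ hs]
  have hpre : (SimpleFunc.const X c).restrict s ⁻¹' {c} = s := by
    ext x
    by_cases hx : x ∈ s <;> simp [SimpleFunc.restrict_apply _ hs, hx, hc.symm]
  rw [elemIntegral, Finset.sum_eq_single c, hpre]
  · intro r hr hrc
    obtain ⟨x, rfl⟩ := SimpleFunc.mem_range.1 hr
    by_cases hx : x ∈ s <;> simp_all [SimpleFunc.restrict_apply _ hs]
  · intro h
    rw [SimpleFunc.preimage_eq_empty_iff _ _ |>.2 h, μ.empty, smul_zero]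

omit [RieszAlgebra A] in
theorem elemIntegral_const (c : ℝ≥0) :
    elemIntegral μ (SimpleFunc.const X c) = (c : ℝ) • μ univ := by
  rw [← elemIntegral_restrict_const μ c MeasurableSet.univ, SimpleFunc.restrict_univ]

theorem elemIntegral_mul (hμ : IsSpectral μ) (φ ψ : SimpleFunc X ℝ≥0) :
    elemIntegral μ (φ * ψ) = elemIntegral μ φ * elemIntegral μ ψ := by
  classical
  have h1 : elemIntegral μ (φ * ψ) = _ := elemIntegral_map μ (φ.pair ψ) (fun p => p.1 * p.2)
  rw [h1, elemIntegral, elemIntegral, Finset.sum_mul_sum, ← Finset.sum_product']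
  -- Pairs of values that are not attained jointly may be added to the sum, because their fibres are
  -- empty.
  refine (Finset.sum_subset (fun p hp => ?_) fun p _ hp => ?_).trans
    (Finset.sum_congr rfl fun p _ => ?_)
  · obtain ⟨x, rfl⟩ := SimpleFunc.mem_range.1 hp
    simp [SimpleFunc.pair_apply]
  · rw [(SimpleFunc.preimage_eq_empty_iff _ _).2 hp, μ.empty, smul_zero]
  · rw [show φ.pair ψ ⁻¹' {p} = φ ⁻¹' {p.1} ∩ ψ ⁻¹' {p.2} from
      SimpleFunc.pair_preimage_singleton φ ψ p.1 p.2,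
      hμ _ _ (φ.measurableSet_fiber _) (ψ.measurableSet_fiber _), NNReal.coe_mul,
      smul_mul_smul_comm]

/-- An elementary function below the supremum of an increasing sequence of elementary functions
has an integral below every upper bound of the integrals. -/
theorem elemIntegral_le_of_forall_le (hA : SigmaDedekindComplete A) {φ : ℕ → SimpleFunc X ℝ≥0}
    (hφ : ∀ x, Monotone fun n => φ n x) {ψ : SimpleFunc X ℝ≥0}
    (h : ∀ x (c : ℝ≥0), (∀ n, φ n x ≤ c) → ψ x ≤ c) {a : A} (ha : ∀ n, elemIntegral μ (φ n) ≤ a) :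
    elemIntegral μ ψ ≤ a := by
  obtain ⟨C, hC⟩ := ψ.exists_forall_le
  rw [← sub_nonpos]
  refine hA.nonpos_of_le_smul (μ.nonneg univ MeasurableSet.univ) fun ε hε => ?_
  lift ε to ℝ≥0 using hε.le
  have hε' : 0 < ε := by exact_mod_cast hε
  -- The exceptional sets where `φ n` misses `ψ` by more than `ε`. A point in all of them would make
  -- `ψ x - ε` a bound of the `φ n x`, so they decrease to `∅`.
  let E : ℕ → Set X := fun n => {x | φ n x + ε < ψ x}
  have hE : ∀ n, MeasurableSet (E n) := fun n =>
    measurableSet_lt ((φ n).measurable.add_const ε) ψ.measurable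
  have hEanti : Antitone E := fun m n hmn x hx =>
    lt_of_le_of_lt (add_le_add_left (hφ x hmn) ε) hx
  have hEempty : ⋂ n, E n = ∅ := by
    refine eq_empty_of_forall_notMem fun x hx => ?_
    have hx' : ∀ n, φ n x + ε < ψ x := fun n => mem_iInter.1 hx n
    have h1 : ψ x ≤ ψ x - ε := h x _ fun n => le_tsub_of_add_le_right (hx' n).le
    exact absurd h1 (not_le.2 (tsub_lt_self (pos_of_gt (hx' 0)) hε'))
  have hkey : ∀ n, elemIntegral μ ψ ≤ a + (ε : ℝ) • μ univ + (C : ℝ) • μ (E n) := fun n => by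
    have h1 : elemIntegral μ ψ ≤ elemIntegral μ
        (φ n + SimpleFunc.const X ε + (SimpleFunc.const X C).restrict (E n)) := by
      refine elemIntegral_mono μ fun x => ?_
      by_cases hx : x ∈ E n
      · simpa [SimpleFunc.restrict_apply _ (hE n), hx] using le_add_left (hC x)
      · simpa [SimpleFunc.restrict_apply _ (hE n), hx] using not_lt.1 hx
    rw [elemIntegral_add, elemIntegral_add, elemIntegral_const,
      elemIntegral_restrict_const μ C (hE n)] at h1
    exact h1.trans (add_le_add_left (add_le_add_left (ha n) _) _)
  -- Dividing by `C` leaves a lower bound of all `μ (E n)`, which is therefore nonpositive; `C = 0`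
  -- is treated apart.
  rw [← sub_nonpos]
  rcases eq_or_ne C 0 with rfl | hC0
  · have := hkey 0
    rw [NNReal.coe_zero, zero_smul, add_zero] at this
    rwa [sub_sub, sub_nonpos]
  have hCpos : (0 : ℝ) < C := NNReal.coe_pos.2 (pos_iff_ne_zero.2 hC0)
  have h2 : (C : ℝ)⁻¹ • (elemIntegral μ ψ - a - (ε : ℝ) • μ univ) ≤ 0 :=
    μ.nonpos_of_le_of_antitone hE hEanti hEempty fun n => by
      have h3 := smul_le_smul_of_nonneg_left (sub_le_iff_le_add'.2 (hkey n))
        (inv_nonneg.2 hCpos.le)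
      rwa [smul_smul, inv_mul_cancel₀ hCpos.ne', one_smul, ← sub_sub] at h3
  have h4 := smul_le_smul_of_nonneg_left h2 hCpos.le
  rwa [smul_smul, mul_inv_cancel₀ hCpos.ne', one_smul, smul_zero] at h4

/-- Both integrals lie below one common multiple of the measures of the supports, and these measures
are disjoint because the supports are. -/
theorem elemIntegral_inf_eq_zero
    (hμ : ∀ s t, MeasurableSet s → MeasurableSet t → μ (s ∩ t) = μ s ⊓ μ t)
    {φ ψ : SimpleFunc X ℝ≥0} (h : ∀ x, φ x ⊓ ψ x = 0) :
    elemIntegral μ φ ⊓ elemIntegral μ ψ = 0 := by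
  obtain ⟨C, hC⟩ := φ.exists_forall_le
  obtain ⟨D, hD⟩ := ψ.exists_forall_le
  have hbound : ∀ (θ : SimpleFunc X ℝ≥0), (∀ x, θ x ≤ max C D) →
      elemIntegral μ θ ≤ ((max C D : ℝ≥0) : ℝ) • μ (θ ⁻¹' {0}ᶜ) := fun θ hθ => by
    rw [← elemIntegral_restrict_const μ _ (θ.measurableSet_preimage _)]
    refine elemIntegral_mono μ fun x => ?_
    rw [SimpleFunc.restrict_apply _ (θ.measurableSet_preimage _)]
    by_cases hx : θ x = 0
    · simp [hx]
    · rw [indicator_of_mem (by simpa using hx)]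
      exact hθ x
  have hsupp : μ (φ ⁻¹' {0}ᶜ) ⊓ μ (ψ ⁻¹' {0}ᶜ) = 0 := by
    rw [← hμ _ _ (φ.measurableSet_preimage _) (ψ.measurableSet_preimage _), ← μ.empty]
    congr 1
    refine eq_empty_of_forall_notMem fun x hx => ?_
    rcases min_eq_iff.1 (h x) with h' | h'
    · exact hx.1 h'.1
    · exact hx.2 h'.1
  refine le_antisymm ?_ (le_inf (elemIntegral_nonneg μ φ) (elemIntegral_nonneg μ ψ))
  rw [← smul_inf_smul_eq_zero (μ.nonneg _ (φ.measurableSet_preimage _))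
    (μ.nonneg _ (ψ.measurableSet_preimage _)) hsupp (NNReal.coe_nonneg (max C D))]
  exact inf_le_inf (hbound φ fun x => (hC x).trans (le_max_left _ _))
    (hbound ψ fun x => (hD x).trans (le_max_right _ _))

end Elementary

/-! ### The order integral as a supremum -/

section Integral

variable {X A : Type*} [MeasurableSpace X] [NonUnitalRing A] [Module ℝ A] [Lattice A]
  {μ : FiniteMeasure X A}

theorem HasOrderIntegral.measurable {f : X → ℝ≥0} {a : A} (hf : HasOrderIntegral μ f a) :
    Measurable f := by
  obtain ⟨φ, hmono, hlub, -⟩ := hf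
  exact measurable_of_tendsto_metrizable (fun n => (φ n).measurable)
    (tendsto_pi_nhds.2 fun x => tendsto_atTop_isLUB (hmono x) (hlub x))

variable [RieszAlgebra A]

theorem elemIntegral_monotone {φ : ℕ → SimpleFunc X ℝ≥0} (hφ : ∀ x, Monotone fun n => φ n x) :
    Monotone fun n => elemIntegral μ (φ n) :=
  fun _ _ hmn => elemIntegral_mono μ fun x => hφ x hmn

omit [RieszAlgebra A] in
theorem hasOrderIntegral_simpleFunc (φ : SimpleFunc X ℝ≥0) :
    HasOrderIntegral μ φ (elemIntegral μ φ) :=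
  ⟨fun _ => φ, fun _ => monotone_const, fun x => by simp, by simp⟩

theorem HasOrderIntegral.mono (hA : SigmaDedekindComplete A) {f g : X → ℝ≥0} {a b : A}
    (hf : HasOrderIntegral μ f a) (hg : HasOrderIntegral μ g b) (hfg : ∀ x, f x ≤ g x) :
    a ≤ b := by
  obtain ⟨φ, -, hφ, ha⟩ := hf
  obtain ⟨ψ, hψmono, hψ, hb⟩ := hg
  refine ha.2 ?_
  rintro _ ⟨n, rfl⟩
  refine elemIntegral_le_of_forall_le μ hA hψmono (fun x c hc => ?_) fun m => hb.1 ⟨m, rfl⟩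
  exact ((hφ x).1 ⟨n, rfl⟩).trans ((hfg x).trans ((hψ x).2 (by rintro _ ⟨m, rfl⟩; exact hc m)))

theorem HasOrderIntegral.unique (hA : SigmaDedekindComplete A) {f : X → ℝ≥0} {a b : A}
    (ha : HasOrderIntegral μ f a) (hb : HasOrderIntegral μ f b) : a = b :=
  le_antisymm (ha.mono hA hb fun _ => le_rfl) (hb.mono hA ha fun _ => le_rfl)

theorem HasOrderIntegral.nonneg {f : X → ℝ≥0} {a : A} (hf : HasOrderIntegral μ f a) : 0 ≤ a := by
  obtain ⟨φ, -, -, ha⟩ := hf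
  exact (elemIntegral_nonneg μ (φ 0)).trans (ha.1 ⟨0, rfl⟩)

theorem exists_simpleFunc_approx {f : X → ℝ≥0} (hf : Measurable f) :
    ∃ φ : ℕ → SimpleFunc X ℝ≥0, (∀ x, Monotone fun n => φ n x) ∧
      ∀ x, IsLUB (range fun n => φ n x) (f x) := by
  have hf' : Measurable fun x => (f x : ENNReal) := hf.coe_nnreal_ennreal
  -- The approximants in `ENNReal` are finite everywhere, so truncation to `ℝ≥0` keeps them
  -- increasing.
  have hne := fun n x => (SimpleFunc.eapprox_lt_top (fun x => (f x : ENNReal)) n x).ne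
  have hmono : ∀ x, Monotone fun n =>
      ((SimpleFunc.eapprox (fun x => (f x : ENNReal)) n).map ENNReal.toNNReal) x :=
    fun x m n hmn => ENNReal.toNNReal_mono (hne n x) (SimpleFunc.monotone_eapprox _ hmn x)
  refine ⟨_, hmono, fun x => isLUB_of_tendsto_atTop (hmono x) ?_⟩
  exact (ENNReal.tendsto_toNNReal ENNReal.coe_ne_top).comp (SimpleFunc.tendsto_eapprox hf' x)

/-- A measurable function dominated by one with a finite integral has a finite integral. -/
theorem HasOrderIntegral.exists_of_le (hA : SigmaDedekindComplete A) {f g : X → ℝ≥0} {b : A}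
    (hg : HasOrderIntegral μ g b) (hf : Measurable f) (hfg : ∀ x, f x ≤ g x) :
    ∃ a, HasOrderIntegral μ f a := by
  obtain ⟨φ, hmono, hlub⟩ := exists_simpleFunc_approx hf
  obtain ⟨a, ha⟩ := hA (range fun n => elemIntegral μ (φ n)) (range_nonempty _)
    (countable_range _) ⟨b, by
      rintro _ ⟨n, rfl⟩
      exact (hasOrderIntegral_simpleFunc (φ n)).mono hA hg fun x =>
        ((hlub x).1 ⟨n, rfl⟩).trans (hfg x)⟩
  exact ⟨a, φ, hmono, hlub, ha⟩

theorem HasOrderIntegral.add {f g : X → ℝ≥0} {a b : A} (hf : HasOrderIntegral μ f a)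
    (hg : HasOrderIntegral μ g b) : HasOrderIntegral μ (fun x => f x + g x) (a + b) := by
  obtain ⟨φ, hφmono, hφ, ha⟩ := hf
  obtain ⟨ψ, hψmono, hψ, hb⟩ := hg
  have hmono : ∀ x, Monotone fun n => (φ n + ψ n) x := fun x m n hmn =>
    add_le_add (hφmono x hmn) (hψmono x hmn)
  refine ⟨fun n => φ n + ψ n, hmono, fun x => isLUB_of_tendsto_atTop (hmono x)
    ((tendsto_atTop_isLUB (hφmono x) (hφ x)).add (tendsto_atTop_isLUB (hψmono x) (hψ x))), ?_⟩
  simp only [elemIntegral_add]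
  exact isLUB_add_of_monotone (elemIntegral_monotone hφmono) (elemIntegral_monotone hψmono) ha hb

theorem HasOrderIntegral.const_mul {f : X → ℝ≥0} {a : A} (hf : HasOrderIntegral μ f a)
    (r : ℝ≥0) : HasOrderIntegral μ (fun x => r * f x) ((r : ℝ) • a) := by
  obtain ⟨φ, hφmono, hφ, ha⟩ := hf
  have hmono : ∀ x, Monotone fun n => ((φ n).map (r * ·)) x := fun x m n hmn =>
    mul_le_mul_right (hφmono x hmn) r
  refine ⟨_, hmono, fun x => isLUB_of_tendsto_atTop (hmono x)
    ((tendsto_atTop_isLUB (hφmono x) (hφ x)).const_mul r), ?_⟩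
  simp only [elemIntegral_map_mul]
  exact isLUB_smul ha r.2

theorem HasOrderIntegral.mul (hmul : SigmaMonotoneContinuousMul A) (hμ : IsSpectral μ)
    {f g : X → ℝ≥0} {a b : A} (hf : HasOrderIntegral μ f a)
    (hg : HasOrderIntegral μ g b) : HasOrderIntegral μ (fun x => f x * g x) (a * b) := by
  obtain ⟨φ, hφmono, hφ, ha⟩ := hf
  obtain ⟨ψ, hψmono, hψ, hb⟩ := hg
  have hmono : ∀ x, Monotone fun n => (φ n * ψ n) x := fun x m n hmn =>
    mul_le_mul' (hφmono x hmn) (hψmono x hmn)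
  refine ⟨fun n => φ n * ψ n, hmono, fun x => isLUB_of_tendsto_atTop (hmono x)
    ((tendsto_atTop_isLUB (hφmono x) (hφ x)).mul (tendsto_atTop_isLUB (hψmono x) (hψ x))), ?_⟩
  simp only [elemIntegral_mul μ hμ]
  exact isLUB_mul_of_monotone hmul (fun _ => elemIntegral_nonneg μ _)
    (fun _ => elemIntegral_nonneg μ _) (elemIntegral_monotone hφmono)
    (elemIntegral_monotone hψmono) ha hb

theorem HasOrderIntegral.inf_eq_zero
    (hμ : ∀ s t, MeasurableSet s → MeasurableSet t → μ (s ∩ t) = μ s ⊓ μ t)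
    {f g : X → ℝ≥0} {a b : A} (hf : HasOrderIntegral μ f a) (hg : HasOrderIntegral μ g b)
    (hfg : ∀ x, f x ⊓ g x = 0) : a ⊓ b = 0 := by
  have ha0 := hf.nonneg
  have hb0 := hg.nonneg
  obtain ⟨φ, hφmono, hφ, ha⟩ := hf
  obtain ⟨ψ, hψmono, hψ, hb⟩ := hg
  -- Disjointness is passed to the limit in one variable at a time.
  refine inf_eq_zero_of_isLUB hb0 ha0 ha fun n => ?_
  rw [inf_comm]
  refine inf_eq_zero_of_isLUB (elemIntegral_nonneg μ _) hb0 hb fun m => ?_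
  refine elemIntegral_inf_eq_zero μ hμ fun x => le_antisymm ?_ (zero_le)
  rw [← hfg x, inf_comm]
  exact inf_le_inf ((hφ x).1 ⟨n, rfl⟩) ((hψ x).1 ⟨m, rfl⟩)

/-- `f` is integrable with integral `c`, as witnessed by a splitting of `f` into a difference of
nonnegative functions. -/
def HasIntegral (μ : FiniteMeasure X A) (f : X → ℝ) (c : A) : Prop :=
  ∃ (u v : X → ℝ≥0) (a b : A), HasOrderIntegral μ u a ∧ HasOrderIntegral μ v b ∧
    (∀ x, f x = u x - v x) ∧ c = a - b

theorem posIntegral_eq (hA : SigmaDedekindComplete A) {f : X → ℝ≥0} {a : A}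
    (hf : HasOrderIntegral μ f a) : posIntegral μ f = a := by
  have h : ∃ a, HasOrderIntegral μ f a := ⟨a, hf⟩
  rw [posIntegral, dif_pos h]
  exact h.choose_spec.unique hA hf

theorem exists_parts_of_mem_L1 (hA : SigmaDedekindComplete A) {f : X → ℝ} (hf : f ∈ L1 μ) :
    ∃ a b, HasOrderIntegral μ (fun x => (f x).toNNReal) a ∧
      HasOrderIntegral μ (fun x => (-f x).toNNReal) b ∧ integral μ f = a - b := by
  obtain ⟨hm, c, hc⟩ := hf
  obtain ⟨a, ha⟩ := hc.exists_of_le hA hm.real_toNNReal fun x => by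
    rw [← NNReal.coe_le_coe, Real.coe_nnabs, Real.coe_toNNReal']
    exact max_le (le_abs_self _) (abs_nonneg _)
  obtain ⟨b, hb⟩ := hc.exists_of_le (f := fun x => (-f x).toNNReal) hA hm.neg.real_toNNReal fun x => by
    rw [← NNReal.coe_le_coe, Real.coe_nnabs, Real.coe_toNNReal']
    exact max_le (neg_le_abs _) (abs_nonneg _)
  exact ⟨a, b, ha, hb, by rw [integral, posIntegral_eq hA ha, posIntegral_eq hA hb]⟩

theorem hasIntegral_integral (hA : SigmaDedekindComplete A) {f : X → ℝ} (hf : f ∈ L1 μ) :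
    HasIntegral μ f (integral μ f) := by
  obtain ⟨a, b, ha, hb, hab⟩ := exists_parts_of_mem_L1 hA hf
  refine ⟨_, _, a, b, ha, hb, fun x => ?_, hab⟩
  rw [Real.coe_toNNReal', Real.coe_toNNReal']
  rcases le_total 0 (f x) with h | h <;> simp [h]

/-! ### Calculus of signed integrals -/

namespace HasIntegral

theorem mem_L1 (hA : SigmaDedekindComplete A) {f : X → ℝ} {c : A} (hf : HasIntegral μ f c) :
    f ∈ L1 μ := by
  obtain ⟨u, v, a, b, ha, hb, hfx, -⟩ := hf
  have hm : Measurable f := by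
    rw [funext hfx]
    exact ha.measurable.coe_nnreal_real.sub hb.measurable.coe_nnreal_real
  refine ⟨hm, (ha.add hb).exists_of_le hA ?_ fun x => ?_⟩
  · simpa only [Real.nnabs_of_nonneg (abs_nonneg _), ← Real.toNNReal_abs] using
      hm.abs.real_toNNReal
  · rw [← NNReal.coe_le_coe, Real.coe_nnabs, hfx, NNReal.coe_add]
    exact (abs_sub _ _).trans_eq (by simp)

/-- Two splittings `u - v = u' - v'` give `u' + v = u + v'`, an identity between nonnegative
functions, where additivity and uniqueness apply. -/
theorem integral_eq (hA : SigmaDedekindComplete A) {f : X → ℝ} {c : A}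
    (hf : HasIntegral μ f c) : integral μ f = c := by
  obtain ⟨u', v', a', b', ha', hb', hfx', h'⟩ := hasIntegral_integral hA (hf.mem_L1 hA)
  obtain ⟨u, v, a, b, ha, hb, hfx, h⟩ := hf
  have h1 := ha'.add hb
  have h2 := ha.add hb'
  have h3 : (fun x => u' x + v x) = fun x => u x + v' x := by
    funext x
    rw [← NNReal.coe_inj, NNReal.coe_add, NNReal.coe_add]
    linarith [hfx x, hfx' x]
  rw [h3] at h1
  rw [h', h, sub_eq_sub_iff_add_eq_add]
  exact h1.unique hA h2

theorem add {f g : X → ℝ} {c d : A} (hf : HasIntegral μ f c) (hg : HasIntegral μ g d) :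
    HasIntegral μ (f + g) (c + d) := by
  obtain ⟨u, v, a, b, ha, hb, hfx, rfl⟩ := hf
  obtain ⟨u', v', a', b', ha', hb', hgx, rfl⟩ := hg
  refine ⟨_, _, _, _, ha.add ha', hb.add hb', fun x => ?_, by abel⟩
  rw [Pi.add_apply, hfx, hgx, NNReal.coe_add, NNReal.coe_add]
  ring

omit [RieszAlgebra A] in
theorem neg {f : X → ℝ} {c : A} (hf : HasIntegral μ f c) : HasIntegral μ (-f) (-c) := by
  obtain ⟨u, v, a, b, ha, hb, hfx, rfl⟩ := hf
  exact ⟨_, _, _, _, hb, ha, fun x => by rw [Pi.neg_apply, hfx, neg_sub], by abel⟩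

theorem smul {f : X → ℝ} {c : A} (hf : HasIntegral μ f c) (r : ℝ) :
    HasIntegral μ (r • f) (r • c) := by
  -- Only nonnegative scalars preserve suprema; negative ones are reached through `neg`.
  have key : ∀ r : ℝ≥0, HasIntegral μ ((r : ℝ) • f) ((r : ℝ) • c) := fun r => by
    obtain ⟨u, v, a, b, ha, hb, hfx, rfl⟩ := hf
    refine ⟨_, _, _, _, ha.const_mul r, hb.const_mul r, fun x => ?_, smul_sub _ _ _⟩
    rw [Pi.smul_apply, smul_eq_mul, hfx, NNReal.coe_mul, NNReal.coe_mul, mul_sub]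
  rcases le_total 0 r with h | h
  · exact key ⟨r, h⟩
  · have := (key (-r).toNNReal).neg
    rwa [Real.coe_toNNReal _ (neg_nonneg.2 h), neg_smul, neg_smul, neg_neg, neg_neg] at this

theorem mul (hmul : SigmaMonotoneContinuousMul A) (hμ : IsSpectral μ) {f g : X → ℝ} {c d : A}
    (hf : HasIntegral μ f c) (hg : HasIntegral μ g d) : HasIntegral μ (f * g) (c * d) := by
  obtain ⟨u, v, a, b, ha, hb, hfx, rfl⟩ := hf
  obtain ⟨u', v', a', b', ha', hb', hgx, rfl⟩ := hg
  refine ⟨_, _, _, _, (ha.mul hmul hμ ha').add (hb.mul hmul hμ hb'),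
    (ha.mul hmul hμ hb').add (hb.mul hmul hμ ha'), fun x => ?_, ?_⟩
  · rw [Pi.mul_apply, hfx, hgx]
    push_cast
    ring
  · rw [sub_mul, mul_sub, mul_sub]
    abel

end HasIntegral

omit [RieszAlgebra A] in
theorem hasIntegral_indicator {s : Set X} (hs : MeasurableSet s) :
    HasIntegral μ (s.indicator 1) (μ s) := by
  refine ⟨_, _, _, _, hasOrderIntegral_simpleFunc ((SimpleFunc.const X 1).restrict s),
    hasOrderIntegral_simpleFunc (SimpleFunc.const X 0), fun x => ?_, ?_⟩
  · by_cases hx : x ∈ s <;> simp [SimpleFunc.restrict_apply _ hs, hx]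
  · rw [elemIntegral_restrict_const μ 1 hs, elemIntegral_const, NNReal.coe_one, one_smul,
      NNReal.coe_zero, zero_smul, sub_zero]

theorem boundedMeasurable_subset_L1 (hA : SigmaDedekindComplete A) :
    boundedMeasurable X ⊆ L1 μ := by
  rintro f ⟨hm, C, hC⟩
  have hconst := hasOrderIntegral_simpleFunc (μ := μ) (SimpleFunc.const X C.toNNReal)
  refine ⟨hm, hconst.exists_of_le hA ?_ fun x => ?_⟩
  · simpa only [Real.nnabs_of_nonneg (abs_nonneg _), ← Real.toNNReal_abs] using
      hm.abs.real_toNNReal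
  · rw [← NNReal.coe_le_coe, Real.coe_nnabs]
    exact (hC x).trans (Real.le_coe_toNNReal C)

theorem indicator_mem_boundedMeasurable {s : Set X} (hs : MeasurableSet s) :
    (s.indicator 1 : X → ℝ) ∈ boundedMeasurable X :=
  ⟨measurable_one.indicator hs, 1, fun x => by by_cases hx : x ∈ s <;> simp [hx]⟩

end Integral

/-! ### Algebra and vector lattice homomorphisms -/

section Homomorphisms

variable {X A : Type*} [MeasurableSpace X] [NonUnitalRing A] [Module ℝ A] [Lattice A]

/-- The algebra of bounded measurable functions. -/
def boundedMeasurableSubalgebra (X : Type*) [MeasurableSpace X] :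
    NonUnitalSubalgebra ℝ (X → ℝ) where
  carrier := boundedMeasurable X
  zero_mem' := ⟨measurable_zero, 0, fun x => by simp⟩
  add_mem' := by
    rintro f g ⟨hf, C, hC⟩ ⟨hg, D, hD⟩
    exact ⟨hf.add hg, C + D, fun x => (abs_add_le _ _).trans (add_le_add (hC x) (hD x))⟩
  mul_mem' := by
    rintro f g ⟨hf, C, hC⟩ ⟨hg, D, hD⟩
    refine ⟨hf.mul hg, C * D, fun x => ?_⟩
    rw [Pi.mul_apply, abs_mul]
    exact mul_le_mul (hC x) (hD x) (abs_nonneg _) ((abs_nonneg _).trans (hC x))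
  smul_mem' := by
    rintro r f ⟨hf, C, hC⟩
    refine ⟨hf.const_smul r, |r| * C, fun x => ?_⟩
    rw [Pi.smul_apply, smul_eq_mul, abs_mul]
    exact mul_le_mul_of_nonneg_left (hC x) (abs_nonneg r)

theorem sup_inf_mem_boundedMeasurable {f g : X → ℝ} (hf : f ∈ boundedMeasurable X)
    (hg : g ∈ boundedMeasurable X) :
    f ⊔ g ∈ boundedMeasurable X ∧ f ⊓ g ∈ boundedMeasurable X := by
  obtain ⟨hfm, C, hC⟩ := hf
  obtain ⟨hgm, D, hD⟩ := hg
  exact ⟨⟨hfm.sup hgm, max C D, fun x => abs_max_le_max_abs_abs.trans (max_le_max (hC x) (hD x))⟩,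
    ⟨hfm.inf hgm, max C D, fun x => abs_min_le_max_abs_abs.trans (max_le_max (hC x) (hD x))⟩⟩

omit [MeasurableSpace X] [Lattice A] in
theorem IsAlgebraHomOn.restrict {T : (X → ℝ) → A} {S : Set (X → ℝ)} (h : IsAlgebraHomOn T S)
    (R' : NonUnitalSubalgebra ℝ (X → ℝ)) (hR' : (R' : Set (X → ℝ)) ⊆ S) :
    IsAlgebraHomOn T (R' : Set (X → ℝ)) := by
  obtain ⟨R, Φ, rfl, hΦ⟩ := h
  have hle : R' ≤ R := hR'
  exact ⟨R', Φ.comp (NonUnitalSubalgebra.inclusion hle), rfl, fun f => hΦ ⟨f, hle f.2⟩⟩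

omit [MeasurableSpace X] [Lattice A] in
theorem IsAlgebraHomOn.map_mul {T : (X → ℝ) → A} {S : Set (X → ℝ)} (h : IsAlgebraHomOn T S)
    {f g : X → ℝ} (hf : f ∈ S) (hg : g ∈ S) : T (f * g) = T f * T g := by
  obtain ⟨R, Φ, rfl, hΦ⟩ := h
  have h1 := _root_.map_mul Φ ⟨f, hf⟩ ⟨g, hg⟩
  rwa [hΦ, hΦ, hΦ] at h1

omit [MeasurableSpace X] in
theorem IsVectorLatticeHomOn.restrict {T : (X → ℝ) → A} {S : Set (X → ℝ)}
    (h : IsVectorLatticeHomOn T S) (R' : Submodule ℝ (X → ℝ)) (hR' : (R' : Set (X → ℝ)) ⊆ S)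
    (hlat : ∀ f ∈ R', ∀ g ∈ R', f ⊔ g ∈ R' ∧ f ⊓ g ∈ R') :
    IsVectorLatticeHomOn T (R' : Set (X → ℝ)) := by
  obtain ⟨-, ⟨R, Φ, rfl, hΦ⟩, h3⟩ := h
  have hle : R' ≤ R := hR'
  exact ⟨hlat, ⟨R', Φ.comp (Submodule.inclusion hle), rfl, fun f => hΦ ⟨f, hle f.2⟩⟩,
    fun f hf g hg => h3 f (hle hf) g (hle hg)⟩

variable [RieszAlgebra A] {μ : FiniteMeasure X A}

theorem zero_mem_L1 (hA : SigmaDedekindComplete A) : (0 : X → ℝ) ∈ L1 μ :=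
  boundedMeasurable_subset_L1 hA (boundedMeasurableSubalgebra X).zero_mem

theorem isAlgebraHomOn_L1_of_isSpectral (hA : SigmaDedekindComplete A)
    (hmul : SigmaMonotoneContinuousMul A) (hμ : IsSpectral μ) :
    IsAlgebraHomOn (integral μ) (L1 μ) := by
  have key := fun {f : X → ℝ} (hf : f ∈ L1 μ) => hasIntegral_integral hA hf
  let R : NonUnitalSubalgebra ℝ (X → ℝ) :=
    { carrier := L1 μ
      zero_mem' := zero_mem_L1 hA
      add_mem' := fun hf hg => ((key hf).add (key hg)).mem_L1 hA
      mul_mem' := fun hf hg => ((key hf).mul hmul hμ (key hg)).mem_L1 hA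
      smul_mem' := fun r f hf => ((key hf).smul r).mem_L1 hA }
  let Φ : R →ₙₐ[ℝ] A :=
    { toFun := fun f => integral μ f
      map_smul' := fun r f => ((key f.2).smul r).integral_eq hA
      map_zero' := by
        have := ((key (zero_mem_L1 hA)).smul 0).integral_eq hA
        rwa [zero_smul, zero_smul] at this
      map_add' := fun f g => ((key f.2).add (key g.2)).integral_eq hA
      map_mul' := fun f g => ((key f.2).mul hmul hμ (key g.2)).integral_eq hA }
  exact ⟨R, Φ, rfl, fun _ => rfl⟩

theorem isSpectral_of_isAlgebraHomOn (hA : SigmaDedekindComplete A)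
    (h : IsAlgebraHomOn (integral μ) (boundedMeasurable X)) : IsSpectral μ := fun s t hs ht => by
  have h1 := h.map_mul (indicator_mem_boundedMeasurable hs) (indicator_mem_boundedMeasurable ht)
  rw [← inter_indicator_one, (hasIntegral_indicator (hs.inter ht)).integral_eq hA,
    (hasIntegral_indicator hs).integral_eq hA, (hasIntegral_indicator ht).integral_eq hA] at h1
  exact h1

/-- Products over disjoint sets vanish, so splitting `s` and `t` along `s ∩ t` leaves only the
square of `μ (s ∩ t)`. -/
theorem isSpectral_of_isIdempotent_of_commute
    (hidem : ∀ s, MeasurableSet s → μ s * μ s = μ s)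
    (hcomm : ∀ s t, MeasurableSet s → MeasurableSet t → μ s * μ t = μ t * μ s) :
    IsSpectral μ := by
  have hdisj : ∀ s t, MeasurableSet s → MeasurableSet t → Disjoint s t → μ s * μ t = 0 := by
    intro s t hs ht hst
    have h1 := hidem _ (hs.union ht)
    rw [μ.union hs ht hst, add_mul, mul_add, mul_add, hidem s hs, hidem t ht,
      hcomm t s ht hs] at h1
    have h2 : (2 : ℝ) • (μ s * μ t) = 0 := by
      rw [two_smul]
      calc μ s * μ t + μ s * μ t
          = μ s + μ s * μ t + (μ s * μ t + μ t) - (μ s + μ t) := by abel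
        _ = 0 := by rw [h1, sub_self]
    simpa using h2
  intro s t hs ht
  have hst := hs.inter ht
  have h1 := μ.inter_add_diff hs ht
  have h2 := μ.inter_add_diff ht hs
  rw [inter_comm] at h2
  rw [← h1, ← h2, add_mul, mul_add, mul_add, hidem _ hst,
    hdisj _ _ hst (ht.diff hs) (disjoint_sdiff_right.mono_left inter_subset_left),
    hdisj _ _ (hs.diff ht) hst (disjoint_sdiff_left.mono_right inter_subset_right),
    hdisj _ _ (hs.diff ht) (ht.diff hs) (disjoint_sdiff_left.mono_right sdiff_subset)]
  simp

theorem integral_posPart (hA : SigmaDedekindComplete A)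
    (hμ : ∀ s t, MeasurableSet s → MeasurableSet t → μ (s ∩ t) = μ s ⊓ μ t) {f : X → ℝ}
    (hf : f ∈ L1 μ) : HasIntegral μ (f ⊔ 0) (integral μ f ⊔ 0) := by
  obtain ⟨a, b, ha, hb, hab⟩ := exists_parts_of_mem_L1 hA hf
  have hinf : a ⊓ b = 0 := ha.inf_eq_zero hμ hb fun x => by
    rcases le_total 0 (f x) with h | h <;> simp [h]
  refine ⟨_, _, _, _, ha, hasOrderIntegral_simpleFunc (SimpleFunc.const X 0), fun x => by simp, ?_⟩
  rw [elemIntegral_const, NNReal.coe_zero, zero_smul, sub_zero, hab]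
  -- After adding `b`, the claim `(a - b) ⊔ 0 = a` reads `a ⊔ b = a + b`, which is disjointness.
  rw [← add_left_inj b, sup_add, sub_add_cancel, zero_add, add_eq_sup_of_inf_eq_zero hinf]

theorem isVectorLatticeHomOn_L1 (hA : SigmaDedekindComplete A)
    (hμ : ∀ s t, MeasurableSet s → MeasurableSet t → μ (s ∩ t) = μ s ⊓ μ t) :
    IsVectorLatticeHomOn (integral μ) (L1 μ) := by
  have key := fun {f : X → ℝ} (hf : f ∈ L1 μ) => hasIntegral_integral hA hf
  have hsup : ∀ f ∈ L1 μ, ∀ g ∈ L1 μ, HasIntegral μ (f ⊔ g) (integral μ f ⊔ integral μ g) := by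
    intro f hf g hg
    -- Translation reduces suprema to positive parts: `f ⊔ g = (f - g) ⊔ 0 + g`.
    have hsub := (key hf).add (key hg).neg
    have h1 := (integral_posPart hA hμ (hsub.mem_L1 hA)).add (key hg)
    rwa [hsub.integral_eq hA, sup_add, sup_add, neg_add_cancel_right, neg_add_cancel_right,
      zero_add, zero_add] at h1
  have hinf : ∀ f ∈ L1 μ, ∀ g ∈ L1 μ, HasIntegral μ (f ⊓ g) (integral μ f ⊓ integral μ g) := by
    intro f hf g hg
    -- Infima follow from `f ⊓ g = f + g - f ⊔ g`.
    have h1 := ((key hf).add (key hg)).add (hsup f hf g hg).neg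
    rwa [← inf_add_sup f g, ← inf_add_sup (integral μ f), add_neg_cancel_right,
      add_neg_cancel_right] at h1
  let R : Submodule ℝ (X → ℝ) :=
    { carrier := L1 μ
      zero_mem' := zero_mem_L1 hA
      add_mem' := fun hf hg => ((key hf).add (key hg)).mem_L1 hA
      smul_mem' := fun r f hf => ((key hf).smul r).mem_L1 hA }
  let Φ : R →ₗ[ℝ] A :=
    { toFun := fun f => integral μ f
      map_smul' := fun r f => ((key f.2).smul r).integral_eq hA
      map_add' := fun f g => ((key f.2).add (key g.2)).integral_eq hA }
  exact ⟨fun f hf g hg => ⟨(hsup f hf g hg).mem_L1 hA, (hinf f hf g hg).mem_L1 hA⟩,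
    ⟨R, Φ, rfl, fun _ => rfl⟩,
    fun f hf g hg => ⟨(hsup f hf g hg).integral_eq hA, (hinf f hf g hg).integral_eq hA⟩⟩

theorem measure_inter_eq_inf_of_isVectorLatticeHomOn (hA : SigmaDedekindComplete A)
    (h : IsVectorLatticeHomOn (integral μ) (boundedMeasurable X)) :
    ∀ s t, MeasurableSet s → MeasurableSet t → μ (s ∩ t) = μ s ⊓ μ t := fun s t hs ht => by
  have h1 := (h.2.2 _ (indicator_mem_boundedMeasurable hs) _
    (indicator_mem_boundedMeasurable ht)).2
  have h2 : (s.indicator 1 ⊓ t.indicator 1 : X → ℝ) = (s ∩ t).indicator 1 := by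
    funext x
    by_cases hx : x ∈ s <;> by_cases hx' : x ∈ t <;> simp [hx, hx']
  rwa [h2, (hasIntegral_indicator (hs.inter ht)).integral_eq hA,
    (hasIntegral_indicator hs).integral_eq hA, (hasIntegral_indicator ht).integral_eq hA] at h1

/-- The common summand `μ (s ∩ t)` can be pulled out of the infimum, leaving that of the disjoint
differences. -/
theorem measure_inter_eq_inf_of_disjoint
    (h : ∀ s t, MeasurableSet s → MeasurableSet t → Disjoint s t → μ s ⊓ μ t = 0) :
    ∀ s t, MeasurableSet s → MeasurableSet t → μ (s ∩ t) = μ s ⊓ μ t := fun s t hs ht => by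
  have h1 := μ.inter_add_diff hs ht
  have h2 := μ.inter_add_diff ht hs
  rw [inter_comm] at h2
  rw [← h1, ← h2, ← add_inf, h _ _ (hs.diff ht) (ht.diff hs)
    (disjoint_sdiff_left.mono_right sdiff_subset), add_zero]

/-- Orthogonal idempotents below a positive identity element are disjoint. -/
theorem inf_eq_zero_of_le_one {e p q : A} (he : ∀ a : A, e * a = a ∧ a * e = a) (hp0 : 0 ≤ p)
    (hq0 : 0 ≤ q) (hpe : p ≤ e) (hpp : p * p = p) (hpq : p * q = 0) : p ⊓ q = 0 := by
  have hw : 0 ≤ p ⊓ q := le_inf hp0 hq0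
  -- Since `(e - p) p = 0`, this yields `p ⊓ q ≤ p (p ⊓ q)`, which is at most `p q = 0`.
  have h1 : (e - p) * (p ⊓ q) ≤ (e - p) * p :=
    mul_le_mul_of_nonneg' le_rfl inf_le_left (sub_nonneg.2 hpe) hw
  have h2 : p * (p ⊓ q) ≤ p * q := mul_le_mul_of_nonneg' le_rfl inf_le_right hp0 hw
  rw [sub_mul, sub_mul, (he _).1, (he _).1, hpp, sub_self, sub_nonpos] at h1
  exact le_antisymm (h1.trans (h2.trans hpq.le)) hw

theorem inf_eq_zero_of_isSemiprime (hsemi : IsSemiprime A) {p q : A} (hp0 : 0 ≤ p)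
    (hq0 : 0 ≤ q) (hpq : p * q = 0) : p ⊓ q = 0 := by
  have hw : 0 ≤ p ⊓ q := le_inf hp0 hq0
  have h1 : (p ⊓ q) * (p ⊓ q) ≤ p * q := mul_le_mul_of_nonneg' inf_le_left inf_le_right hp0 hw
  -- One iteration means the square, and `(p ⊓ q)²` is squeezed between `0` and `p q`.
  exact hsemi _ ⟨1, le_antisymm (h1.trans hpq.le) (RieszAlgebra.mul_nonneg _ _ hw hw)⟩

theorem IsSpectral.measure_inter_eq_inf (hμ : IsSpectral μ)
    (h : (∃ e : A, 0 ≤ e ∧ (∀ a : A, e * a = a ∧ a * e = a) ∧ μ univ ≤ e) ∨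
      (IsFAlgebra A ∧ IsSemiprime A)) :
    ∀ s t, MeasurableSet s → MeasurableSet t → μ (s ∩ t) = μ s ⊓ μ t := by
  refine measure_inter_eq_inf_of_disjoint fun s t hs ht hst => ?_
  have hst' : μ s * μ t = 0 := by rw [← hμ s t hs ht, hst.inter_eq, μ.empty]
  rcases h with ⟨e, -, he, hle⟩ | ⟨-, hsemi⟩
  · refine inf_eq_zero_of_le_one he (μ.nonneg s hs) (μ.nonneg t ht)
      ((μ.mono hs MeasurableSet.univ (subset_univ s)).trans hle) ?_ hst'
    rw [← hμ s s hs hs, inter_self]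
  · exact inf_eq_zero_of_isSemiprime hsemi (μ.nonneg s hs) (μ.nonneg t ht) hst'

/-! ### The two lists of equivalences -/

theorem tfae_isAlgebraHomOn (hA : SigmaDedekindComplete A) (hmul : SigmaMonotoneContinuousMul A)
    (μ : FiniteMeasure X A) :
    List.TFAE [IsAlgebraHomOn (integral μ) (L1 μ),
      IsAlgebraHomOn (integral μ) (boundedMeasurable X), IsSpectral μ,
      (∀ s, MeasurableSet s → μ s * μ s = μ s) ∧
        ∀ s t, MeasurableSet s → MeasurableSet t → μ s * μ t = μ t * μ s] := by
  tfae_have 1 → 2 := fun h =>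
    h.restrict (boundedMeasurableSubalgebra X) (boundedMeasurable_subset_L1 hA)
  tfae_have 2 → 3 := isSpectral_of_isAlgebraHomOn hA
  tfae_have 3 → 1 := isAlgebraHomOn_L1_of_isSpectral hA hmul
  tfae_have 3 → 4 := fun h => ⟨fun s hs => by rw [← h s s hs hs, inter_self],
    fun s t hs ht => by rw [← h s t hs ht, ← h t s ht hs, inter_comm]⟩
  tfae_have 4 → 3 := fun h => isSpectral_of_isIdempotent_of_commute h.1 h.2
  tfae_finish

theorem tfae_isVectorLatticeHomOn (hA : SigmaDedekindComplete A) (μ : FiniteMeasure X A) :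
    List.TFAE [IsVectorLatticeHomOn (integral μ) (L1 μ),
      IsVectorLatticeHomOn (integral μ) (boundedMeasurable X),
      ∀ s t, MeasurableSet s → MeasurableSet t → μ (s ∩ t) = μ s ⊓ μ t] := by
  tfae_have 1 → 2 := fun h => h.restrict (boundedMeasurableSubalgebra X).toSubmodule
    (boundedMeasurable_subset_L1 hA) fun _ hf _ hg => sup_inf_mem_boundedMeasurable hf hg
  tfae_have 2 → 3 := measure_inter_eq_inf_of_isVectorLatticeHomOn hA
  tfae_have 3 → 1 := isVectorLatticeHomOn_L1 hA
  tfae_finish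

end Homomorphisms

end OrderIntegration

theorem mainTheorem8 {X A : Type*} [MeasurableSpace X]
    [NonUnitalRing A] [Module ℝ A] [Lattice A] [OrderIntegration.RieszAlgebra A]
    (hA : OrderIntegration.SigmaDedekindComplete A)
    (hmul : OrderIntegration.SigmaMonotoneContinuousMul A)
    (μ : OrderIntegration.FiniteMeasure X A) :
    List.TFAE [
      OrderIntegration.IsAlgebraHomOn (OrderIntegration.integral μ) (OrderIntegration.L1 μ),
      OrderIntegration.IsAlgebraHomOn (OrderIntegration.integral μ)
        (OrderIntegration.boundedMeasurable X),
      OrderIntegration.IsSpectral μ,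
      (∀ s, MeasurableSet s → μ s * μ s = μ s) ∧
        ∀ s t, MeasurableSet s → MeasurableSet t → μ s * μ t = μ t * μ s] ∧
    List.TFAE [
      OrderIntegration.IsVectorLatticeHomOn (OrderIntegration.integral μ) (OrderIntegration.L1 μ),
      OrderIntegration.IsVectorLatticeHomOn (OrderIntegration.integral μ)
        (OrderIntegration.boundedMeasurable X),
      ∀ s t, MeasurableSet s → MeasurableSet t → μ (s ∩ t) = μ s ⊓ μ t] ∧
    (((∃ e : A, 0 ≤ e ∧ (∀ a : A, e * a = a ∧ a * e = a) ∧ μ Set.univ ≤ e) ∨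
        (OrderIntegration.IsFAlgebra A ∧ OrderIntegration.IsSemiprime A)) →
      (OrderIntegration.IsAlgebraHomOn (OrderIntegration.integral μ) (OrderIntegration.L1 μ) ∨
        OrderIntegration.IsAlgebraHomOn (OrderIntegration.integral μ)
          (OrderIntegration.boundedMeasurable X) ∨
        OrderIntegration.IsSpectral μ ∨
        ((∀ s, MeasurableSet s → μ s * μ s = μ s) ∧
          ∀ s t, MeasurableSet s → MeasurableSet t → μ s * μ t = μ t * μ s)) →
      (OrderIntegration.IsVectorLatticeHomOn (OrderIntegration.integral μ)
          (OrderIntegration.L1 μ) ∧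
        OrderIntegration.IsVectorLatticeHomOn (OrderIntegration.integral μ)
          (OrderIntegration.boundedMeasurable X) ∧
        ∀ s t, MeasurableSet s → MeasurableSet t → μ (s ∩ t) = μ s ⊓ μ t)) := by
  have halg := OrderIntegration.tfae_isAlgebraHomOn hA hmul μ
  have hlat := OrderIntegration.tfae_isVectorLatticeHomOn hA μ
  refine ⟨halg, hlat, fun hcase h => ?_⟩
  have hspec : OrderIntegration.IsSpectral μ := by
    rcases h with h | h | h | h
    · exact (halg.out 0 2).1 h
    · exact (halg.out 1 2).1 h
    · exact h
    · exact (halg.out 3 2).1 h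
  have h7 := hspec.measure_inter_eq_inf hcase
  exact ⟨(hlat.out 2 0).1 h7, (hlat.out 2 1).1 h7, h7⟩
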